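/- \textbf{Conventions.} A clause is a finite set of literals (a literal is a variable $x$ or its negation $\neg x$), and a CNF formula $f$ is a finite set of clauses; its variables are those occurring, negated or not, in some clause of $f$. The graph $\mathrm{LCN}(f)$ (literal-clause graph with negation connections) has as nodes the two literals $x,\neg x$ of every variable $x$ of $f$ and the clauses of $f$; its edges are the pairs $\{x,\neg x\}$, and the pairs $\{\ell,c\}$ where the literal $\ell$ belongs to the clause $c$. The two kinds of edges have different edge colours, and the nodes carry no labels. For a partial assignment $\sigma$ of the variables of $f$, $\mathrm{LCN}(\sigma(f))$ denotes the graph $\mathrm{LCN}(f)$ in which each literal made true by $\sigma$ is additionally labelled $\top$, each literal made false by $\sigma$ is labelled $\bot$, and all other nodes have no label. On a finite node- and edge-coloured graph $G$, the Weisfeiler--Leman algorithm (1-WL) starts with the node colouring $\chi^0$ and sets $\chi^{\ell+1}(v)=\bigl(\chi^{\ell}(v),(\{\!\{\chi^{\ell}(w): w\in N_c(v)\}\!\})_{c}\bigr)$, where $c$ ranges over the edge colours and $N_c(v)$ is the set of neighbours of $v$ through edges of colour $c$. The $k$-WL algorithm colours $k$-tuples of nodes: $\chi^0(\bar v)$ is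 the atomic type of $\bar v$ (which entries coincide, which are adjacent and through which edge colour, and the node colours), and $\chi^{\ell+1}(\bar v)=(\chi^{\ell}(\bar v),\chi^{\ell}_1(\bar v),\dots,\chi^{\ell}_k(\bar v))$ with $\chi^{\ell}_i(\bar v)=\{\!\{\chi^{\ell}(v_1,\dots,v_{i-1},u,v_{i+1},\dots,v_k): u\in V(G)\}\!\}$. To compare two graphs $G,H$, the algorithm is run on both simultaneously until the partition of all nodes (respectively $k$-tuples) of $G$ and $H$ into colour classes no longer changes; $G$ and $H$ are \emph{indistinguishable} by 1-WL (respectively $k$-WL) if every colour of this stable colouring is taken by the same number of nodes (respectively $k$-tuples) in $G$ and in $H$. \textbf{Lemma.} Let $k\ge 4$ and let $f,\tilde f$ be CNF formulas such that $\mathrm{LCN}(f)$ and $\mathrm{LCN}(\tilde f)$ are indistinguishable by $k$-WL. Then for every partial assignment $\sigma$ of the variables of $f$ that sets at most $\lfloor k/2\rfloor-1$ variables there is a partial assignment $\tilde\sigma$ of the variables of $\tilde f$ such that $\mathrm{LCN}(\sigma(f))$ and $\mathrm{LCN}(\tilde\sigma(\tilde f))$ are indistinguishable by 1-WL. -/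

import Mathlib

/-! ### Coloured graphs -/

/-- A simple undirected graph on `V` with a node colouring and an edge colouring. Only the values
of `edgeColor` on edges of `graph` are ever used. -/
structure ColoredGraph (V : Type*) (C D : Type) where
  graph : SimpleGraph V
  nodeColor : V → C
  edgeColor : Sym2 V → D

/-! ### Stable rounds of a refinement process -/

/-- The partition of `X` given by round `ℓ` equals the partition given by round `ℓ + 1`. -/
def IsStableRound {X : Type*} {K : ℕ → Type} (χ : (ℓ : ℕ) → X → K ℓ) (ℓ : ℕ) : Prop :=
  ∀ x y, χ ℓ x = χ ℓ y ↔ χ (ℓ + 1) x = χ (ℓ + 1) y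

/-- A refinement process on a finite set becomes stable. -/
theorem exists_isStableRound {X : Type*} [Finite X] {K : ℕ → Type} (χ : (ℓ : ℕ) → X → K ℓ)
    (href : ∀ ℓ x y, χ (ℓ + 1) x = χ (ℓ + 1) y → χ ℓ x = χ ℓ y) :
    ∃ ℓ, IsStableRound χ ℓ := by
  by_contra hno
  let S : ℕ → Set (X × X) := fun ℓ => {p | χ ℓ p.1 = χ ℓ p.2}
  have hanti : ∀ ℓ, S (ℓ + 1) ⊂ S ℓ := by
    intro ℓ
    refine ⟨fun p hp => href ℓ p.1 p.2 hp, fun hsub => hno ⟨ℓ, fun x y => ⟨fun h => ?_, href ℓ x y⟩⟩⟩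
    exact hsub (show (x, y) ∈ S ℓ from h)
  have hlt : ∀ ℓ, (S (ℓ + 1)).ncard < (S ℓ).ncard := fun ℓ =>
    Set.ncard_lt_ncard (hanti ℓ) (Set.toFinite _)
  have hle : ∀ ℓ, (S ℓ).ncard + ℓ ≤ (S 0).ncard := by
    intro ℓ
    induction ℓ with
    | zero => simp
    | succ n ih => have := hlt n; omega
  have := hle ((S 0).ncard + 1)
  omega

/-! ### The Weisfeiler-Leman algorithm (colour refinement, 1-WL) -/

/-- Colours of round `ℓ`: `χ^{ℓ+1}(v)` consists of `χ^ℓ(v)` and, for each edge colour `c`, the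
multiset of the colours `χ^ℓ(w)`, `w ∈ N_c(v)`. -/
def WLColor (C D : Type) : ℕ → Type
  | 0 => C
  | ℓ + 1 => WLColor C D ℓ × (D → Multiset (WLColor C D ℓ))

namespace ColoredGraph

variable {V W : Type*} {C D : Type}

open Classical in
/-- The neighbours `N_c(v)` of `v` through edges of colour `c`. -/
noncomputable def nbrs [Fintype V] (G : ColoredGraph V C D) (c : D) (v : V) : Finset V :=
  {w | G.graph.Adj v w ∧ G.edgeColor s(v, w) = c}

/-- The colouring `χ^ℓ` computed by the WL algorithm in round `ℓ`. -/
noncomputable def wl [Fintype V] (G : ColoredGraph V C D) : (ℓ : ℕ) → V → WLColor C D ℓ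
  | 0, v => G.nodeColor v
  | ℓ + 1, v => (G.wl ℓ v, fun c => (G.nbrs c v).val.map (G.wl ℓ))

/-- The WL colouring `χ^ℓ` of the disjoint union of `G` and `H`; no neighbourhood of the disjoint
union meets both graphs, so the algorithm computes the colours on each side separately. -/
noncomputable def wlPair [Fintype V] [Fintype W] (G : ColoredGraph V C D) (H : ColoredGraph W C D)
    (ℓ : ℕ) : V ⊕ W → WLColor C D ℓ :=
  Sum.elim (G.wl ℓ) (H.wl ℓ)

theorem exists_isStableRound_wlPair [Fintype V] [Fintype W]
    (G : ColoredGraph V C D) (H : ColoredGraph W C D) : ∃ ℓ, IsStableRound (wlPair G H) ℓ := by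
  apply exists_isStableRound
  rintro ℓ (x | x) (y | y) h <;> exact congrArg Prod.fst h

open Classical in
/-- The round after which the WL algorithm on the two graphs stops. -/
noncomputable def wlRound [Fintype V] [Fintype W]
    (G : ColoredGraph V C D) (H : ColoredGraph W C D) : ℕ :=
  Nat.find (exists_isStableRound_wlPair G H)

/-- The WL test does not distinguish `G` and `H`: every colour of the stable colouring is taken
equally often in both graphs. -/
def WLIndistinguishable [Fintype V] [Fintype W]
    (G : ColoredGraph V C D) (H : ColoredGraph W C D) : Prop :=
  ∀ c : WLColor C D (wlRound G H),
    {v : V | G.wl (wlRound G H) v = c}.ncard = {w : W | H.wl (wlRound G H) w = c}.ncard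

end ColoredGraph

/-! ### The `k`-dimensional Weisfeiler-Leman algorithm -/

/-- The data recorded by the atomic type of a `k`-tuple: the node colours, which entries coincide,
and which entries are joined by an edge, together with the colour of that edge. -/
@[ext]
structure AtomicType (k : ℕ) (C D : Type) where
  nodeColor : Fin k → C
  same : Fin k → Fin k → Prop
  edge : Fin k → Fin k → Option D

/-- Colours of round `ℓ` of the `k`-WL algorithm: `χ^{ℓ+1}` consists of `χ^ℓ` and the `k` multisets
obtained by exchanging one entry of the tuple. -/
def KWLColor (k : ℕ) (C D : Type) : ℕ → Type
  | 0 => AtomicType k C D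
  | ℓ + 1 => KWLColor k C D ℓ × (Fin k → Multiset (KWLColor k C D ℓ))

namespace ColoredGraph

variable {V W : Type*} {C D : Type}

open Classical in
/-- The atomic type of a tuple. Two tuples have the same atomic type iff `v i ↦ u i` is an
isomorphism of the induced coloured subgraphs. -/
noncomputable def atomicType {k : ℕ} (G : ColoredGraph V C D) (v : Fin k → V) :
    AtomicType k C D where
  nodeColor i := G.nodeColor (v i)
  same i j := v i = v j
  edge i j := if G.graph.Adj (v i) (v j) then some (G.edgeColor s(v i, v j)) else none

/-- The colouring `χ^ℓ` of the `k`-tuples computed by the `k`-WL algorithm in round `ℓ`. -/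
noncomputable def kwl [Fintype V] (k : ℕ) (G : ColoredGraph V C D) :
    (ℓ : ℕ) → (Fin k → V) → KWLColor k C D ℓ
  | 0, v => G.atomicType v
  | ℓ + 1, v => (G.kwl k ℓ v,
      fun i => (Finset.univ : Finset V).val.map fun u => G.kwl k ℓ (Function.update v i u))

/-- The `k`-WL colourings `χ^ℓ` of the tuples of `G` and of the tuples of `H`. -/
noncomputable def kwlPair [Fintype V] [Fintype W] (k : ℕ)
    (G : ColoredGraph V C D) (H : ColoredGraph W C D) (ℓ : ℕ) :
    (Fin k → V) ⊕ (Fin k → W) → KWLColor k C D ℓ :=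
  Sum.elim (G.kwl k ℓ) (H.kwl k ℓ)

theorem exists_isStableRound_kwlPair [Fintype V] [Fintype W] (k : ℕ)
    (G : ColoredGraph V C D) (H : ColoredGraph W C D) :
    ∃ ℓ, IsStableRound (kwlPair k G H) ℓ := by
  apply exists_isStableRound
  rintro ℓ (x | x) (y | y) h <;> exact congrArg Prod.fst h

open Classical in
/-- The round after which the `k`-WL algorithm on the two graphs stops. -/
noncomputable def kwlRound [Fintype V] [Fintype W] (k : ℕ)
    (G : ColoredGraph V C D) (H : ColoredGraph W C D) : ℕ :=
  Nat.find (exists_isStableRound_kwlPair k G H)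

/-- The `k`-WL test does not distinguish `G` and `H`: every colour of the stable colouring is taken
by equally many `k`-tuples of both graphs. -/
def KWLIndistinguishable [Fintype V] [Fintype W] (k : ℕ)
    (G : ColoredGraph V C D) (H : ColoredGraph W C D) : Prop :=
  ∀ c : KWLColor k C D (kwlRound k G H),
    {v : Fin k → V | G.kwl k (kwlRound k G H) v = c}.ncard =
      {w : Fin k → W | H.kwl k (kwlRound k G H) w = c}.ncard

end ColoredGraph

/-! ### CNF formulas and their literal-clause graphs with negation connections -/

/-- The literal `(x, true)` is the variable `x`, the literal `(x, false)` is its negation. -/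
abbrev Literal (X : Type*) := X × Bool

/-- A clause is a finite set of literals, read as their disjunction. -/
abbrev CNFClause (X : Type*) := Finset (Literal X)

/-- A formula in conjunctive normal form is a finite set of clauses. -/
abbrev CNFFormula (X : Type*) := Finset (CNFClause X)

namespace CNFFormula

variable {X : Type*}

open Classical in
/-- The variables of a formula: those that occur, negated or not, in one of its clauses. -/
noncomputable def vars (f : CNFFormula X) : Finset X :=
  f.biUnion fun c => c.image Prod.fst

/-- The nodes of the literal-clause graph: both literals of each variable of `f`, and the
clauses of `f`. -/
abbrev Node (f : CNFFormula X) := ({x // x ∈ f.vars} × Bool) ⊕ {c // c ∈ f}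

/-- The two colours of edges in the literal-clause graph with negation connections. -/
inductive EdgeKind where
  | literalLiteral
  | literalClause

/-- One orientation of each edge: `x` to `¬ x`, and each literal to each clause it appears in. -/
def lcnRel (f : CNFFormula X) : f.Node → f.Node → Prop
  | .inl (x, a), .inl (y, b) => x = y ∧ a ≠ b
  | .inl (x, a), .inr c => ((x : X), a) ∈ (c : CNFClause X)
  | .inr _, _ => False

/-- The underlying graph of the literal-clause graph with negation connections. -/
def lcnGraph (f : CNFFormula X) : SimpleGraph f.Node := SimpleGraph.fromRel f.lcnRel

open Classical in
/-- Edges between two literals and edges between a literal and a clause have different colours. -/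
noncomputable def lcnEdgeColor (f : CNFFormula X) (e : Sym2 f.Node) : EdgeKind :=
  if ∀ v ∈ e, v.isLeft = true then .literalLiteral else .literalClause

/-- `LCN(f)`, the literal-clause graph with negation connections, without node labels. -/
noncomputable def LCN (f : CNFFormula X) : ColoredGraph f.Node Unit EdgeKind where
  graph := f.lcnGraph
  nodeColor _ := ()
  edgeColor := f.lcnEdgeColor

/-- A partial assignment of the variables of `f`; `none` means that the variable is not set. -/
abbrev PartialAssignment (f : CNFFormula X) := {x // x ∈ f.vars} → Option Bool

/-- The number of variables set by a partial assignment. -/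
noncomputable def PartialAssignment.numSet {f : CNFFormula X} (σ : f.PartialAssignment) : ℕ :=
  (Finset.univ.filter fun x => (σ x).isSome).card

/-- `LCN(σ(f))`: the graph `LCN(f)` in which a literal is labelled `some true` (that is, `⊤`) if
`σ` makes it true, `some false` (that is, `⊥`) if `σ` makes it false, and all other nodes have the
default label `none`. -/
noncomputable def labeledLCN (f : CNFFormula X) (σ : f.PartialAssignment) :
    ColoredGraph f.Node (Option Bool) EdgeKind where
  graph := f.lcnGraph
  nodeColor
    | .inl (x, b) => (σ x).map fun a => a == b
    | .inr _ => none
  edgeColor := f.lcnEdgeColor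

end CNFFormula

/-! Pin both literals of every variable set by `σ` as entries of a `k`-tuple `p`. This uses at most
`2 * (k / 2 - 1) ≤ k - 2` positions, so two positions `a`, `b` stay free. Indistinguishability gives
a tuple `q` of the other graph with the same stable colour. Atomic types show that complementary
literals sit at the corresponding entries of `q`, and `σ'` is read off from them. A label then says
only that a node equals one of certain pinned entries, which `k`-WL sees.

The free positions simulate 1-WL (`wlIndistinguishable_of_kwlEquiv`): one holds a node while the
other runs through its possible neighbours. The bijections needed come from the back-and-forth
property `KWLEquiv.exists_equiv`. -/

/-- Two functions on finite types with the same multiset of values differ by a bijection. -/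
theorem exists_equiv_of_map_univ_eq {α β γ : Type*} [Fintype α] [Fintype β] {φ : α → γ}
    {ψ : β → γ} (h : (Finset.univ : Finset α).val.map φ = (Finset.univ : Finset β).val.map ψ) :
    ∃ e : α ≃ β, ∀ x, ψ (e x) = φ x := by
  classical
  have hcard : ∀ c, Fintype.card {x // φ x = c} = Fintype.card {y // ψ y = c} := by
    intro c
    have hc := congrArg (Multiset.count c) h
    rw [Multiset.count_map, Multiset.count_map] at hc
    rw [Fintype.card_subtype, Fintype.card_subtype, Finset.card_def, Finset.card_def,
      Finset.filter_val, Finset.filter_val]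
    simpa only [eq_comm] using hc
  exact ⟨Equiv.ofFiberEquiv fun c => Fintype.equivOfCardEq (hcard c),
    fun x => Equiv.ofFiberEquiv_map _ x⟩

/-! ### Stable `k`-WL colours and the simulation of 1-WL -/

namespace ColoredGraph

variable {V W : Type*} {C C' D : Type}

theorem atomicType_edge_eq_some {k : ℕ} {G : ColoredGraph V C D} {v : Fin k → V} {i j : Fin k}
    {c : D} : (G.atomicType v).edge i j = some c ↔
      G.graph.Adj (v i) (v j) ∧ G.edgeColor s(v i, v j) = c := by
  simp [atomicType]

variable [Fintype V] [Fintype W]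

/-- Equality of the stable `k`-WL colours of a tuple of `G` and a tuple of `H`. -/
def KWLEquiv (k : ℕ) (G : ColoredGraph V C D) (H : ColoredGraph W C D)
    (v : Fin k → V) (w : Fin k → W) : Prop :=
  G.kwl k (kwlRound k G H) v = H.kwl k (kwlRound k G H) w

theorem atomicType_eq_of_kwl_eq {k : ℕ} {G : ColoredGraph V C D} {H : ColoredGraph W C D}
    {v : Fin k → V} {w : Fin k → W} :
    ∀ ℓ, G.kwl k ℓ v = H.kwl k ℓ w → G.atomicType v = H.atomicType w
  | 0, h => h
  | ℓ + 1, h => atomicType_eq_of_kwl_eq ℓ (congrArg Prod.fst h)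

theorem KWLEquiv.atomicType_eq {k : ℕ} {G : ColoredGraph V C D} {H : ColoredGraph W C D}
    {v : Fin k → V} {w : Fin k → W} (h : KWLEquiv k G H v w) :
    G.atomicType v = H.atomicType w :=
  atomicType_eq_of_kwl_eq _ h

theorem KWLEquiv.eq_iff {k : ℕ} {G : ColoredGraph V C D} {H : ColoredGraph W C D}
    {v : Fin k → V} {w : Fin k → W} (h : KWLEquiv k G H v w) (i j : Fin k) :
    v i = v j ↔ w i = w j :=
  iff_of_eq (congrFun (congrFun (congrArg AtomicType.same h.atomicType_eq) i) j)

theorem KWLEquiv.edge_iff {k : ℕ} {G : ColoredGraph V C D} {H : ColoredGraph W C D}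
    {v : Fin k → V} {w : Fin k → W} (h : KWLEquiv k G H v w) (i j : Fin k) (c : D) :
    (G.graph.Adj (v i) (v j) ∧ G.edgeColor s(v i, v j) = c) ↔
      (H.graph.Adj (w i) (w j) ∧ H.edgeColor s(w i, w j) = c) := by
  rw [← atomicType_edge_eq_some, ← atomicType_edge_eq_some, h.atomicType_eq]

/-- The back-and-forth property of the stable `k`-WL colouring. -/
theorem KWLEquiv.exists_equiv {k : ℕ} {G : ColoredGraph V C D} {H : ColoredGraph W C D}
    {v : Fin k → V} {w : Fin k → W} (h : KWLEquiv k G H v w) (i : Fin k) :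
    ∃ e : V ≃ W, ∀ u, KWLEquiv k G H (Function.update v i u) (Function.update w i (e u)) := by
  classical
  have hst : IsStableRound (kwlPair k G H) (kwlRound k G H) :=
    Nat.find_spec (exists_isStableRound_kwlPair k G H)
  -- Stability lifts the equality by one round, and the colour of that round contains the multisets
  -- over exchanged entries.
  have h1 : G.kwl k (kwlRound k G H + 1) v = H.kwl k (kwlRound k G H + 1) w :=
    (hst (Sum.inl v) (Sum.inr w)).1 h
  obtain ⟨e, he⟩ := exists_equiv_of_map_univ_eq (congrFun (congrArg Prod.snd h1) i)
  exact ⟨e, fun u => (he u).symm⟩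

theorem KWLIndistinguishable.exists_kwlEquiv {k : ℕ} {G : ColoredGraph V C D}
    {H : ColoredGraph W C D} (h : KWLIndistinguishable k G H) (v : Fin k → V) :
    ∃ w, KWLEquiv k G H v w := by
  have hpos : 0 < {v' : Fin k → V |
      G.kwl k (kwlRound k G H) v' = G.kwl k (kwlRound k G H) v}.ncard :=
    (Set.ncard_pos (Set.toFinite _)).2 ⟨v, rfl⟩
  rw [h] at hpos
  obtain ⟨w, hw⟩ := (Set.ncard_pos (Set.toFinite _)).1 hpos
  exact ⟨w, Eq.symm hw⟩

/-- The constant tuple at a node of `W` would need a partner in `V`. For `k = 0` this fails, as the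
empty tuple exists on both sides. -/
theorem KWLIndistinguishable.isEmpty {k : ℕ} {G : ColoredGraph V C D}
    {H : ColoredGraph W C D} (hk : k ≠ 0) (h : KWLIndistinguishable k G H) [IsEmpty V] :
    IsEmpty W := by
  refine ⟨fun y => ?_⟩
  have hpos : 0 < {w : Fin k → W |
      H.kwl k (kwlRound k G H) w = H.kwl k (kwlRound k G H) fun _ => y}.ncard :=
    (Set.ncard_pos (Set.toFinite _)).2 ⟨fun _ => y, rfl⟩
  rw [← h] at hpos
  obtain ⟨v, -⟩ := (Set.ncard_pos (Set.toFinite _)).1 hpos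
  exact isEmptyElim (v ⟨0, Nat.pos_of_ne_zero hk⟩)

/-- `k`-WL provides bijections of all nodes, while 1-WL counts neighbours only; a bijection
respecting the edges at `v` and `w` restricts to each neighbourhood `N_c`. -/
theorem wl_succ_eq_of_equiv {G : ColoredGraph V C D} {H : ColoredGraph W C D} {ℓ : ℕ} {v : V}
    {w : W} (hvw : G.wl ℓ v = H.wl ℓ w) (e : V ≃ W) (he : ∀ u, G.wl ℓ u = H.wl ℓ (e u))
    (hadj : ∀ u c, (G.graph.Adj v u ∧ G.edgeColor s(v, u) = c) ↔
      (H.graph.Adj w (e u) ∧ H.edgeColor s(w, e u) = c)) :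
    G.wl (ℓ + 1) v = H.wl (ℓ + 1) w := by
  refine Prod.ext hvw (funext fun c => ?_)
  have hn : H.nbrs c w = (G.nbrs c v).map e.toEmbedding := by
    ext y
    obtain ⟨u, rfl⟩ := e.surjective y
    simp [nbrs, ← hadj]
  change (G.nbrs c v).val.map (G.wl ℓ) = (H.nbrs c w).val.map (H.wl ℓ)
  rw [hn, Finset.map_val, Multiset.map_map]
  exact Multiset.map_congr rfl fun u _ => he u

theorem wlIndistinguishable_of_equiv {G : ColoredGraph V C D} {H : ColoredGraph W C D}
    (e : V ≃ W) (he : ∀ ℓ u, G.wl ℓ u = H.wl ℓ (e u)) : WLIndistinguishable G H := by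
  intro c
  refine Set.ncard_congr (fun u _ => e u) (fun u hu => ?_) (fun u u' _ _ h => e.injective h)
    fun y hy => ?_
  · exact (he _ u).symm.trans hu
  · exact ⟨e.symm y, (he _ _).trans (by rw [e.apply_symm_apply]; exact hy), e.apply_symm_apply y⟩

/-- Two positions of a `k`-tuple suffice to simulate 1-WL, the other ones can be used to
individualize nodes. Here `G'` and `H'` are recoloured versions of `G` and `H` whose node colours
are determined by the stable `k`-WL colours of tuples extending `p` and `q`. -/
theorem wlIndistinguishable_of_kwlEquiv {k : ℕ} {G : ColoredGraph V C D}
    {H : ColoredGraph W C D} {G' : ColoredGraph V C' D} {H' : ColoredGraph W C' D}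
    (hG : G'.graph = G.graph) (hGe : G'.edgeColor = G.edgeColor)
    (hH : H'.graph = H.graph) (hHe : H'.edgeColor = H.edgeColor)
    {a b : Fin k} (hab : a ≠ b) {p : Fin k → V} {q : Fin k → W} (hpq : KWLEquiv k G H p q)
    (hcol : ∀ p' q', KWLEquiv k G H p' q' →
      (∀ i, i ≠ a → i ≠ b → p' i = p i) → (∀ i, i ≠ a → i ≠ b → q' i = q i) →
      ∀ i, G'.nodeColor (p' i) = H'.nodeColor (q' i)) :
    WLIndistinguishable G' H' := by
  have key : ∀ ℓ, ∀ p' q', KWLEquiv k G H p' q' →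
      (∀ i, i ≠ a → i ≠ b → p' i = p i) → (∀ i, i ≠ a → i ≠ b → q' i = q i) →
      ∀ i, G'.wl ℓ (p' i) = H'.wl ℓ (q' i) := by
    intro ℓ
    induction ℓ with
    | zero => exact hcol
    | succ ℓ ih =>
      intro p' q' h hp hq i
      -- The free position to be exchanged must differ from `i`, so that the node being refined
      -- stays in the tuple.
      obtain ⟨j, hji, hj⟩ : ∃ j, j ≠ i ∧ (j = a ∨ j = b) := by
        by_cases hi : a = i
        · exact ⟨b, fun hb => hab (hi.trans hb.symm), Or.inr rfl⟩
        · exact ⟨a, hi, Or.inl rfl⟩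
      have hne : ∀ m, m ≠ a → m ≠ b → m ≠ j := by
        rintro m ha hb rfl
        exact hj.elim ha hb
      obtain ⟨e, he⟩ := h.exists_equiv j
      refine wl_succ_eq_of_equiv (ih p' q' h hp hq i) e (fun u => ?_) fun u c => ?_
      · have := ih _ _ (he u)
          (fun m ha hb => by rw [Function.update_of_ne (hne m ha hb), hp m ha hb])
          (fun m ha hb => by rw [Function.update_of_ne (hne m ha hb), hq m ha hb]) j
        simpa using this
      · have := (he u).edge_iff i j c
        rw [Function.update_of_ne hji.symm, Function.update_of_ne hji.symm,
          Function.update_self, Function.update_self] at this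
        rw [hG, hGe, hH, hHe]
        exact this
  -- One bijection serves all rounds, so the stopping round of 1-WL plays no role.
  obtain ⟨e, he⟩ := hpq.exists_equiv a
  refine wlIndistinguishable_of_equiv e fun ℓ u => ?_
  have := key ℓ _ _ (he u) (fun m ha _ => Function.update_of_ne ha _ _)
    (fun m ha _ => Function.update_of_ne ha _ _) a
  simpa using this

end ColoredGraph

/-! ### Literals and labels in literal-clause graphs -/

namespace CNFFormula

variable {X : Type*}

/-- This lets atomic types recognise complementary literals, although the nodes of `LCN` carry no
labels. -/
theorem lcn_adj_literalLiteral_iff {f : CNFFormula X} {u v : f.Node} :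
    (f.LCN.graph.Adj u v ∧ f.LCN.edgeColor s(u, v) = EdgeKind.literalLiteral) ↔
      ∃ x b, u = .inl (x, b) ∧ v = .inl (x, !b) := by
  rcases u with ⟨x, b⟩ | c <;> rcases v with ⟨y, b'⟩ | c'
  · by_cases h : y = x
    · subst h
      cases b <;> cases b' <;> simp [LCN, lcnGraph, lcnRel, lcnEdgeColor]
    · refine iff_of_false (by simp [LCN, lcnGraph, lcnRel, h, Ne.symm h]) ?_
      rintro ⟨z, d, hx, hy⟩
      simp only [Sum.inl.injEq, Prod.mk.injEq] at hx hy
      exact h (hy.1.trans hx.1.symm)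
  all_goals simp [LCN, lcnEdgeColor]

theorem labeledLCN_nodeColor_eq_some {f : CNFFormula X} {σ : f.PartialAssignment} {u : f.Node}
    {t : Bool} : (f.labeledLCN σ).nodeColor u = some t ↔
      ∃ x b, σ x = some b ∧ u = .inl (x, b == t) := by
  rcases u with ⟨x, b⟩ | c
  · cases b <;> cases t <;> cases h : σ x <;> simp [labeledLCN, h]
  · simp [labeledLCN]

/-- The literals of the variables set by a partial assignment. -/
abbrev PartialAssignment.SetLiteral {f : CNFFormula X} (σ : f.PartialAssignment) :=
  {x // (σ x).isSome} × Bool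

theorem PartialAssignment.card_setLiteral {f : CNFFormula X} (σ : f.PartialAssignment) :
    Fintype.card σ.SetLiteral = 2 * σ.numSet := by
  rw [Fintype.card_prod, Fintype.card_bool, Fintype.card_subtype, mul_comm]
  rfl

/-- Every consistent family of literals is made true by a partial assignment that sets no other
variables. -/
theorem exists_partialAssignment {f : CNFFormula X} {ι : Type*}
    (y : ι → {x // x ∈ f.vars}) (b : ι → Bool) (h : ∀ i j, y i = y j → b i = b j) :
    ∃ σ : f.PartialAssignment, ∀ x t, σ x = some t ↔ ∃ i, y i = x ∧ b i = t := by
  classical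
  refine ⟨fun x => if hx : ∃ i, y i = x then some (b hx.choose) else none, fun x t => ?_⟩
  by_cases hx : ∃ i, y i = x
  · simp only [hx, dite_true, Option.some.injEq]
    refine ⟨fun ht => ⟨_, hx.choose_spec, ht⟩, ?_⟩
    rintro ⟨i, hi, rfl⟩
    exact h _ _ (hx.choose_spec.trans hi.symm)
  · simp only [hx, dite_false, reduceCtorEq, false_iff]
    rintro ⟨i, hi, -⟩
    exact hx ⟨i, hi⟩

end CNFFormula

open ColoredGraph CNFFormula in
theorem mainTheorem2 {X Y : Type*} (f : CNFFormula X) (f' : CNFFormula Y) (k : ℕ) (hk : 4 ≤ k)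
    (hind : ColoredGraph.KWLIndistinguishable k f.LCN f'.LCN)
    (σ : f.PartialAssignment) (hσ : σ.numSet ≤ k / 2 - 1) :
    ∃ σ' : f'.PartialAssignment,
      ColoredGraph.WLIndistinguishable (f.labeledLCN σ) (f'.labeledLCN σ') := by
  classical
  -- A node `v₀` is needed to fill the positions of `p` that are not pinned.
  rcases isEmpty_or_nonempty f.Node with hV | ⟨⟨v₀⟩⟩
  · have hW : IsEmpty f'.Node := hind.isEmpty (by omega)
    exact ⟨fun _ => none, wlIndistinguishable_of_equiv (Equiv.equivOfIsEmpty _ _)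
      fun _ u => isEmptyElim u⟩
  let a : Fin k := ⟨0, by omega⟩
  let b : Fin k := ⟨1, by omega⟩
  have hab : a ≠ b := by simp [a, b]
  obtain ⟨pos⟩ : Nonempty (σ.SetLiteral ↪ {i : Fin k // i ∉ ({a, b} : Finset (Fin k))}) := by
    refine Function.Embedding.nonempty_of_card_le ?_
    rw [σ.card_setLiteral, Fintype.card_subtype_compl, Fintype.card_fin, Fintype.card_coe,
      Finset.card_pair hab]
    omega
  have hpos : ∀ l, (pos l : Fin k) ≠ a ∧ (pos l : Fin k) ≠ b := fun l => by
    simpa using (pos l).2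
  let p : Fin k → f.Node :=
    Function.extend (fun l => (pos l : Fin k)) (fun l => .inl (l.1.1, l.2)) fun _ => v₀
  have hp : ∀ l, p (pos l) = .inl (l.1.1, l.2) := fun l =>
    (Subtype.val_injective.comp pos.injective).extend_apply _ _ l
  obtain ⟨q, hpq⟩ := hind.exists_kwlEquiv p
  -- the value of a set variable and the position of the literal that has truth value `t`
  let val : {x // (σ x).isSome} → Bool := fun x => (σ x.1).get x.2
  have hval : ∀ x, σ x.1 = some (val x) := fun x => (Option.some_get x.2).symm
  let P : {x // (σ x).isSome} → Bool → Fin k := fun x t => pos (x, val x == t)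
  have hpP : ∀ x t, p (P x t) = .inl (x.1, val x == t) := fun x t => hp _
  -- The negation edge between the two pinned literals of `x` reappears in `q`.
  have hqP : ∀ x, ∃ y c, q (P x true) = .inl (y, c) ∧ q (P x false) = .inl (y, !c) := fun x => by
    rw [← lcn_adj_literalLiteral_iff, ← hpq.edge_iff, lcn_adj_literalLiteral_iff]
    exact ⟨x.1, val x, by simp [hpP]⟩
  choose y c hqt hqf using hqP
  have hq : ∀ x t, q (P x t) = .inl (y x, c x == t) := by
    rintro x (_ | _) <;> simp [hqt, hqf]
  -- If two set variables demanded opposite values of one variable, a true entry of `q` would equal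
  -- a false one. Pulled back to `p`, this equality forces the two set variables to coincide.
  obtain ⟨σ', hσ'⟩ := exists_partialAssignment y c fun x x' hy => by
    by_contra hc
    have h1 : q (P x true) = q (P x' false) := by
      rw [hqt, hqf, hy, Bool.eq_not_of_ne hc]
    rw [← hpq.eq_iff, hpP, hpP] at h1
    simp only [Sum.inl.injEq, Prod.mk.injEq] at h1
    obtain rfl := Subtype.ext h1.1
    exact hc rfl
  -- Since both literals of each set variable are pinned, each label class is exactly a set of
  -- entries of `p`.
  have hcolp : ∀ u t, (f.labeledLCN σ).nodeColor u = some t ↔ ∃ x, u = p (P x t) := by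
    intro u t
    rw [labeledLCN_nodeColor_eq_some]
    constructor
    · rintro ⟨x, d, hx, rfl⟩
      refine ⟨⟨x, by simp [hx]⟩, ?_⟩
      rw [hpP]
      simp [val, hx]
    · rintro ⟨x, rfl⟩
      exact ⟨x.1, val x, hval x, hpP x t⟩
  have hcolq : ∀ u t, (f'.labeledLCN σ').nodeColor u = some t ↔ ∃ x, u = q (P x t) := by
    intro u t
    rw [labeledLCN_nodeColor_eq_some]
    constructor
    · rintro ⟨z, d, hz, rfl⟩
      obtain ⟨x, rfl, rfl⟩ := (hσ' z d).1 hz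
      exact ⟨x, (hq x t).symm⟩
    · rintro ⟨x, rfl⟩
      exact ⟨y x, c x, (hσ' _ _).2 ⟨x, rfl, rfl⟩, hq x t⟩
  refine ⟨σ', wlIndistinguishable_of_kwlEquiv (G := f.LCN) (H := f'.LCN) rfl rfl rfl rfl hab
    hpq ?_⟩
  intro p' q' h hp' hq' i
  refine Option.ext fun t => ?_
  rw [hcolp, hcolq]
  refine exists_congr fun x => ?_
  -- Pinned positions avoid `a` and `b`, so the pinned nodes are entries of `p'` and `q'` too, and
  -- the equality type decides the label.
  rw [← hp' _ (hpos _).1 (hpos _).2, ← hq' _ (hpos _).1 (hpos _).2]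
  exact h.eq_iff _ _
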